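/- All algebras are complex, Banach algebras satisfy $\|xy\|\le\|x\|\,\|y\|$, and a unital Banach algebra $B$ has an identity $1_B$ with $\|1_B\|=1$. Let $A$ be a Banach algebra, not necessarily with any identity or approximate identity. For a unital Banach algebra $B$ containing $A$ isometrically as a subalgebra (where $1_B$ need not lie in $A$), let $\mathfrak r_A^B$ be the set of those $x\in A$ with $\operatorname{Re}\varphi(x)\ge 0$ for every state $\varphi$ of $B$ (that is, every $\varphi\in B^*$ with $\|\varphi\|=1=\varphi(1_B)$), and let $\mathfrak r_A=\bigcup_B\mathfrak r_A^B$, the union over all such $B$. For $x \in \mathfrak r_A$ and $r\in[0,1]$ the principal $r$th power of $x$ in $B$ is $x^r=\lim_{\epsilon\to0^+}(x+\epsilon 1_B)^r$, where $(x+\epsilon 1_B)^r$ is given by the Riesz functional calculus and the principal branch of $z^r$. In particular $x^0=1_B$, so the exponent $r=0$ is considered only for those $B$ with $1_B\in A$. Then, for every $r\in[0,1]$: (1) $\mathfrak r_A$ is closed under $r$th powers: if $x\in\mathfrak r_A$, then there is an element $y\in\mathfrak r_A$ such that, for every unital Banach algebra $B$ containing $A$ isometrically as a subalgebra (with $1_B\in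 A$ if $r=0$), the limit defining $x^r$ in $B$ exists and equals $y$. (2) For every unital Banach algebra $B$ containing $A$ isometrically as a subalgebra (with $1_B\in A$ if $r=0$), $\mathfrak r_A^B$ is closed under $r$th powers: if $x\in\mathfrak r_A^B$, then the limit defining $x^r$ in $B$ exists, and $x^r\in\mathfrak r_A^B$. -/

import Mathlib

open Filter Topology

universe u v

noncomputable section

/-- The numerical range of `b` in a unital complex Banach algebra `B`: the set of all values
`φ b`, where `φ` is a state of `B`, that is, a functional of norm one with `φ 1 = 1`. -/
def numRange {B : Type*} [NormedRing B] [NormedAlgebra ℂ B] (b : B) : Set ℂ :=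
  {w | ∃ φ : B →L[ℂ] ℂ, ‖φ‖ = 1 ∧ φ 1 = 1 ∧ φ b = w}

/-- `𝔯_A^B`, where the unital Banach algebra `B` contains `A` by means of the embedding `ι`: all
`x` in `A` whose numerical range in `B` lies in the closed right half plane. -/
def realPosIn {A : Type*} {B : Type*} [NonUnitalNormedRing A] [NormedSpace ℂ A]
    [NormedRing B] [NormedAlgebra ℂ B] (ι : A →ₙₐ[ℂ] B) : Set A :=
  {x | numRange (ι x) ⊆ {w : ℂ | 0 ≤ w.re}}

/-- `𝔯_A`: the union of the sets `𝔯_A^B` over all unital Banach algebras `B` (with `‖1‖ = 1`) that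
contain `A` isometrically as a subalgebra. The identity of `B` need not belong to `A`.
(The universe of `A` is large enough: `B` may always be replaced by `A + ℂ 1_B`.) -/
def realPos (A : Type u) [NonUnitalNormedRing A] [NormedSpace ℂ A] : Set A :=
  {x | ∃ (B : Type u) (_ : NormedRing B) (_ : NormedAlgebra ℂ B) (_ : NormOneClass B)
      (_ : CompleteSpace B) (ι : A →ₙₐ[ℂ] B), Isometry ι ∧ x ∈ realPosIn ι}

/-- `b` is the principal power `a ^ r` given by the Riesz functional calculus, that is,
`b = (2πi)⁻¹ ∮ z ^ r (z - a)⁻¹ dz` over a circle around the spectrum of `a` which, with its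
interior, avoids the half line `(-∞, 0]`; here `z ^ r` is the principal branch. The integral does
not depend on the circle. A circle exists when the spectrum lies in the open right half plane. -/
def IsRieszPow {B : Type*} [NormedRing B] [NormedAlgebra ℂ B] (r : ℝ) (a b : B) : Prop :=
  ∃ (c : ℂ) (R : ℝ), 0 < R ∧ Metric.closedBall c R ⊆ Complex.slitPlane ∧
    spectrum ℂ a ⊆ Metric.ball c R ∧
    b = (2 * (Real.pi : ℂ) * Complex.I)⁻¹ • ∮ z in C(c, R), (z ^ (r : ℂ)) • resolvent a z

/-- `y` is the principal power `x ^ r = lim_{ε → 0+} (x + ε 1) ^ r` in the unital Banach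
algebra `B`, where the powers `(x + ε 1) ^ r` are those of the Riesz functional calculus. -/
def IsPrincipalPow {B : Type*} [NormedRing B] [NormedAlgebra ℂ B] (r : ℝ) (x y : B) : Prop :=
  ∃ p : ℝ → B, (∀ ε : ℝ, 0 < ε → IsRieszPow r (x + algebraMap ℂ B (ε : ℂ)) (p ε)) ∧
    Tendsto p (𝓝[>] 0) (𝓝 y)

end

/-! ### Contour integrals of the resolvent around the spectrum. -/

section Contour

open MeasureTheory Real Metric

variable {B : Type*} [NormedRing B] [NormedAlgebra ℂ B]

/-! For `0 < r < 1` the power is a Stieltjes integral: `x ^ r` is a positive multiple of the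
integral of `t ^ (r - 1) x (x + t)⁻¹` over `t > 0`. The elements `x (x + t)⁻¹` lie in `A` and are
determined by equations inside `A`, although `(x + t)⁻¹` need not lie there. So one algebra in which
`x` is accretive produces them (`exists_isQuasiResolvent`), and they then give the resolvent of `x`
in every other algebra containing `A`, even one where `x` is not accretive. The integral converges
in `A`, which makes the power independent of `B`.

`circleIntegral_cpow_smul_resolvent` identifies the Riesz powers of `x + ε` with such integrals, and
dominated convergence gives the limit as `ε → 0+` (`isPrincipalPow`). Positivity passes under the
integral: accretivity gives `‖t (x + t)⁻¹‖ ≤ 1`, so every state has nonnegative real part on `x (x +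
t)⁻¹ = 1 - t (x + t)⁻¹`. The exponents `0` and `1` are treated directly. -/

theorem mem_resolventSet_of_notMem_ball {a : B} {c : ℂ} {R : ℝ} (h : spectrum ℂ a ⊆ ball c R)
    {z : ℂ} (hz : z ∉ ball c R) : z ∈ resolventSet ℂ a := by
  by_contra hn
  exact hz (h hn)

theorem sphere_subset_resolventSet {a : B} {c : ℂ} {R : ℝ} (h : spectrum ℂ a ⊆ ball c R) :
    sphere c R ⊆ resolventSet ℂ a := fun z hz =>
  mem_resolventSet_of_notMem_ball h (by rw [mem_ball, mem_sphere.1 hz]; exact lt_irrefl _)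

theorem resolvent_mul_sub {a : B} {z : ℂ} (hz : z ∈ resolventSet ℂ a) :
    resolvent a z * (algebraMap ℂ B z - a) = 1 :=
  Ring.inverse_mul_cancel _ hz

theorem sub_mul_resolvent {a : B} {z : ℂ} (hz : z ∈ resolventSet ℂ a) :
    (algebraMap ℂ B z - a) * resolvent a z = 1 :=
  Ring.mul_inverse_cancel _ hz

variable [CompleteSpace B]

theorem continuousOn_resolvent (a : B) : ContinuousOn (resolvent a) (resolventSet ℂ a) :=
  fun _ hz => (spectrum.hasDerivAt_resolvent_const_left hz).continuousAt.continuousWithinAt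

theorem circleIntegral_clm_comp {E F : Type*} [NormedAddCommGroup E] [NormedSpace ℂ E]
    [CompleteSpace E] [NormedAddCommGroup F] [NormedSpace ℂ F] [CompleteSpace F] (L : E →L[ℂ] F)
    {f : ℂ → E} {c : ℂ} {R : ℝ} (hf : CircleIntegrable f c R) :
    ∮ z in C(c, R), L (f z) = L (∮ z in C(c, R), f z) := by
  simp only [circleIntegral]
  rw [← ContinuousLinearMap.intervalIntegral_comp_comm _ hf.out]
  simp

theorem circleIntegrable_smul_resolvent {a : B} {c : ℂ} {R : ℝ} (hR : 0 ≤ R)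
    (h : spectrum ℂ a ⊆ ball c R) {f : ℂ → ℂ} (hf : ContinuousOn f (sphere c R)) :
    CircleIntegrable (fun z => f z • resolvent a z) c R :=
  (hf.smul ((continuousOn_resolvent a).mono (sphere_subset_resolventSet h))).circleIntegrable hR

/-- The integral of the resolvent over any circle around the spectrum is `2πi`. -/
theorem circleIntegral_resolvent {a : B} {c : ℂ} {R : ℝ} (hR : 0 < R)
    (h : spectrum ℂ a ⊆ ball c R) :
    ∮ z in C(c, R), resolvent a z = (2 * (π : ℂ) * Complex.I) • (1 : B) := by
  rw [← sub_eq_zero, ← norm_le_zero_iff]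
  refine le_of_forall_gt_imp_ge_of_dense fun η hη => ?_
  -- On a circle of radius `R'` the resolvent differs from `(z - c)⁻¹` by at most `M ‖resolvent a z‖
  -- / R'`, so the integrals differ by at most `2πM sup ‖resolvent a z‖`. This tends to zero as the
  -- circle is enlarged.
  set M : ℝ := ‖a - algebraMap ℂ B c‖ + 1 with hM
  have hM0 : 0 < M := by positivity
  have hev : ∀ᶠ z in Bornology.cobounded ℂ, ‖resolvent a z‖ < η / (2 * π * M) := by
    have := (spectrum.resolvent_tendsto_cobounded (𝕜 := ℂ) a).norm
    rw [norm_zero] at this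
    exact this.eventually (gt_mem_nhds (by positivity))
  obtain ⟨S, -, hS⟩ := ((hasBasis_cobounded_compl_closedBall c).eventually_iff).1 hev
  obtain ⟨R', hRR', hSR'⟩ : ∃ R', R ≤ R' ∧ S < R' :=
    ⟨max R (S + 1), le_max_left _ _, by linarith [le_max_right R (S + 1)]⟩
  have hR' : 0 < R' := hR.trans_le hRR'
  have h' : spectrum ℂ a ⊆ ball c R' := h.trans (ball_subset_ball hRR')
  have e1 : ∮ z in C(c, R), resolvent a z = ∮ z in C(c, R'), resolvent a z := by
    refine (Complex.circleIntegral_eq_of_differentiable_on_annulus_off_countable hR hRR'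
      Set.countable_empty ?_ ?_).symm
    · exact (continuousOn_resolvent a).mono fun z hz => mem_resolventSet_of_notMem_ball h hz.2
    · exact fun z hz => (spectrum.hasDerivAt_resolvent_const_left
        (mem_resolventSet_of_notMem_ball h fun hz' => hz.1.2
          (ball_subset_closedBall hz'))).differentiableAt
  have e2 : (2 * (π : ℂ) * Complex.I) • (1 : B) = ∮ z in C(c, R'), (z - c)⁻¹ • (1 : B) := by
    rw [circleIntegral.integral_smul_const, circleIntegral.integral_sub_center_inv c hR'.ne']
  have hne : ∀ z ∈ sphere c R', z - c ≠ 0 := fun z hz h0 => by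
    rw [mem_sphere, dist_eq_norm, h0, norm_zero] at hz; exact hR'.ne hz
  rw [e1, e2, ← circleIntegral.integral_sub]
  · calc _ ≤ 2 * π * R' * (R'⁻¹ * (M * (η / (2 * π * M)))) := by
          refine circleIntegral.norm_integral_le_of_norm_le_const hR'.le fun z hz => ?_
          have hzr := sphere_subset_resolventSet h' hz
          have : resolvent a z - (z - c)⁻¹ • (1 : B) =
              (z - c)⁻¹ • ((a - algebraMap ℂ B c) * resolvent a z) := by
            have h1 := sub_mul_resolvent hzr
            rw [← inv_smul_smul₀ (hne z hz) (resolvent a z), ← smul_sub]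
            congr 1
            rw [inv_smul_smul₀ (hne z hz)]
            rw [sub_eq_iff_eq_add, ← h1, ← add_mul, Algebra.smul_def, map_sub]
            congr 1
            abel
          rw [this, norm_smul, norm_inv, ← dist_eq_norm, mem_sphere.1 hz]
          refine mul_le_mul_of_nonneg_left ((norm_mul_le _ _).trans ?_) (by positivity)
          refine mul_le_mul (by linarith) (hS ?_).le (norm_nonneg _) hM0.le
          simp only [Set.mem_compl_iff, mem_closedBall, mem_sphere.1 hz, not_le, hSR']
    _ = η := by field_simp
  · simpa using circleIntegrable_smul_resolvent hR'.le h' (f := fun _ => 1) continuousOn_const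
  · exact (((continuousOn_id.sub continuousOn_const).inv₀ hne).smul
      continuousOn_const).circleIntegrable hR'.le

/-- Since `z • resolvent a z = 1 + a * resolvent a z` and constants integrate to zero, this reduces
to `circleIntegral_resolvent`. -/
theorem circleIntegral_smul_id_resolvent {a : B} {c : ℂ} {R : ℝ} (hR : 0 < R)
    (h : spectrum ℂ a ⊆ ball c R) :
    ∮ z in C(c, R), z • resolvent a z = (2 * (π : ℂ) * Complex.I) • a := by
  have hi := circleIntegrable_smul_resolvent hR.le h (f := fun z => z) continuousOn_id
  have hi1 : CircleIntegrable (resolvent a) c R := by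
    simpa using circleIntegrable_smul_resolvent hR.le h (f := fun _ => 1) continuousOn_const
  have e : ∮ z in C(c, R), z • resolvent a z = ∮ z in C(c, R), (1 - (-a * resolvent a z)) := by
    refine circleIntegral.integral_congr hR.le fun z hz => ?_
    have := sub_mul_resolvent (sphere_subset_resolventSet h hz)
    simp only [Algebra.smul_def]
    rw [← this]; noncomm_ring
  have e3 : ∮ z in C(c, R), -a * resolvent a z = -a * ∮ z in C(c, R), resolvent a z :=
    circleIntegral_clm_comp (ContinuousLinearMap.mul ℂ B (-a)) hi1
  rw [e, circleIntegral.integral_sub (circleIntegrable_const _ _ _), e3,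
    circleIntegral_resolvent hR h]
  · have : ∮ _ in C(c, R), (1 : B) = 0 := by
      have := circleIntegral.integral_smul_const (fun _ => (1 : ℂ)) (1 : B) c R
      simp only [one_smul] at this
      rw [this, Complex.circleIntegral_eq_zero_of_differentiable_on_off_countable hR.le
        Set.countable_empty continuousOn_const (fun _ _ => differentiableAt_const _), zero_smul]
    rw [this]; simp
  · exact (continuousOn_const.mul ((continuousOn_resolvent a).mono
      (sphere_subset_resolventSet h))).circleIntegrable hR.le

/-- The resolvent identity splits the integrand into `(z - s)⁻¹ • resolvent a s`, which integrates
to zero by Cauchy because `s` is outside the disc, and a product whose only varying factor is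
`resolvent a z`. -/
theorem circleIntegral_inv_smul_resolvent {a : B} {c : ℂ} {R : ℝ} (hR : 0 < R)
    (h : spectrum ℂ a ⊆ ball c R) {s : ℂ} (hs : s ∉ closedBall c R) :
    ∮ z in C(c, R), (z - s)⁻¹ • resolvent a z = -(2 * (π : ℂ) * Complex.I) • resolvent a s := by
  have hsr := mem_resolventSet_of_notMem_ball h fun h' => hs (ball_subset_closedBall h')
  have hne : ∀ z ∈ closedBall c R, z - s ≠ 0 := fun z hz h0 => hs (by rwa [← sub_eq_zero.1 h0])
  have hi1 : CircleIntegrable (resolvent a) c R := by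
    simpa using circleIntegrable_smul_resolvent hR.le h (f := fun _ => 1) continuousOn_const
  have e : ∮ z in C(c, R), (z - s)⁻¹ • resolvent a z =
      ∮ z in C(c, R), ((z - s)⁻¹ • resolvent a s - resolvent a z * resolvent a s) := by
    refine circleIntegral.integral_congr hR.le fun z hz => ?_
    have h1 := resolvent_mul_sub (sphere_subset_resolventSet h hz)
    have h2 := sub_mul_resolvent hsr
    have h3 : resolvent a z = resolvent a s - (z - s) • (resolvent a z * resolvent a s) := by
      have : (z - s) • (resolvent a z * resolvent a s) =
          resolvent a z * (algebraMap ℂ B z - a) * resolvent a s -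
          resolvent a z * ((algebraMap ℂ B s - a) * resolvent a s) := by
        have : algebraMap ℂ B z - a = (z - s) • 1 + (algebraMap ℂ B s - a) := by
          rw [Algebra.smul_def, map_sub]; noncomm_ring
        rw [this, mul_add, add_mul, mul_assoc, mul_assoc, smul_mul_assoc, one_mul,
          mul_smul_comm]
        abel
      rw [this, h1, h2]; noncomm_ring
    nth_rw 1 [h3]
    rw [smul_sub, inv_smul_smul₀ (hne z (sphere_subset_closedBall hz))]
  have e3 : ∮ z in C(c, R), resolvent a z * resolvent a s =
      (∮ z in C(c, R), resolvent a z) * resolvent a s :=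
    circleIntegral_clm_comp ((ContinuousLinearMap.mul ℂ B).flip (resolvent a s)) hi1
  have hd : ContinuousOn (fun z : ℂ => (z - s)⁻¹) (closedBall c R) :=
    (continuousOn_id.sub continuousOn_const).inv₀ hne
  rw [e, circleIntegral.integral_sub, e3, circleIntegral.integral_smul_const,
    circleIntegral_resolvent hR h,
    Complex.circleIntegral_eq_zero_of_differentiable_on_off_countable hR.le
        Set.countable_empty hd]
  · simp
  · exact fun z hz => ((differentiableAt_id.sub_const _).inv
      (hne z (ball_subset_closedBall hz.1)))
  · exact ((hd.mono sphere_subset_closedBall).smul continuousOn_const).circleIntegrable hR.le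
  · exact (((continuousOn_resolvent a).mono
      (sphere_subset_resolventSet h)).mul continuousOn_const).circleIntegrable hR.le

end Contour

/-! ### Stieltjes representation of the scalar power on the right half plane. -/

section Scalar

open MeasureTheory Real Set

/-- The kernel in the integral representation of `z ^ r` with respect to the finite measure
`rpowIntegrand₀₁ r t 1 dt = t ^ (r - 1) / (t + 1) dt` on the positive half line. -/
noncomputable def powKernel (t : ℝ) (z : ℂ) : ℂ := (t + 1) * (1 - t * (z + t)⁻¹)

theorem add_ofReal_ne_zero {z : ℂ} (hz : 0 < z.re) {t : ℝ} (ht : 0 ≤ t) : z + t ≠ 0 := by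
  intro h
  have := congrArg Complex.re h
  simp at this
  linarith

theorem powKernel_eq {z : ℂ} (hz : 0 < z.re) {t : ℝ} (ht : 0 ≤ t) :
    powKernel t z = (t + 1) * z * (z + t)⁻¹ := by
  have := add_ofReal_ne_zero hz ht
  unfold powKernel
  field_simp
  ring

/-- Here `min 1 δ * (t + 1) ≤ δ + t ≤ Re (z + t)`. Uniformity in `t` makes the kernel integrable
against the finite weight. -/
theorem norm_add_one_mul_inv_le {δ : ℝ} (hδ : 0 < δ) {z : ℂ} (hz : δ ≤ z.re) {t : ℝ} (ht : 0 ≤ t) :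
    ‖((t : ℂ) + 1) * (z + t)⁻¹‖ ≤ (min 1 δ)⁻¹ := by
  have hm : 0 < min 1 δ := lt_min one_pos hδ
  have h1 : ‖(t : ℂ) + 1‖ = t + 1 := by
    have : (t : ℂ) + 1 = ((t + 1 : ℝ) : ℂ) := by push_cast; rfl
    rw [this, Complex.norm_real, Real.norm_of_nonneg (by linarith)]
  have h2 : min 1 δ * (t + 1) ≤ ‖z + t‖ := by
    refine le_trans ?_ (Complex.re_le_norm _)
    simp only [Complex.add_re, Complex.ofReal_re]
    nlinarith [min_le_left 1 δ, min_le_right 1 δ]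
  have h3 : 0 < ‖z + t‖ := lt_of_lt_of_le (by positivity) h2
  rw [norm_mul, norm_inv, h1, ← div_eq_mul_inv, div_le_iff₀ h3, inv_mul_eq_div, le_div_iff₀ hm]
  linarith

theorem norm_powKernel_le {δ : ℝ} (hδ : 0 < δ) {z : ℂ} (hz : δ ≤ z.re) {t : ℝ} (ht : 0 ≤ t) :
    ‖powKernel t z‖ ≤ ‖z‖ * (min 1 δ)⁻¹ := by
  rw [powKernel_eq (hδ.trans_le hz) ht, mul_comm _ z, mul_assoc, norm_mul]
  gcongr
  exact norm_add_one_mul_inv_le hδ hz ht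

theorem continuousOn_powKernel :
    ContinuousOn (fun p : ℝ × ℂ => powKernel p.1 p.2) (Ici 0 ×ˢ {z | 0 < z.re}) := by
  unfold powKernel
  have : ContinuousOn (fun p : ℝ × ℂ => (p.2 + (p.1 : ℂ))⁻¹) (Ici 0 ×ˢ {z | 0 < z.re}) :=
    ContinuousOn.inv₀ (by fun_prop) fun p hp => add_ofReal_ne_zero hp.2 hp.1
  fun_prop

theorem hasDerivAt_powKernel {z : ℂ} (hz : 0 < z.re) {t : ℝ} (ht : 0 ≤ t) :
    HasDerivAt (powKernel t) ((t + 1) * t * ((z + t)⁻¹) ^ 2) z := by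
  have h0 := add_ofReal_ne_zero hz ht
  have := (((((hasDerivAt_id z).add_const (t : ℂ)).inv h0).const_mul (t : ℂ)).const_sub 1).const_mul
    ((t : ℂ) + 1)
  refine this.congr_deriv ?_
  simp only [id]
  field_simp

variable {r : ℝ}

theorem integrable_weight (hr : r ∈ Ioo 0 1) :
    Integrable (fun t => rpowIntegrand₀₁ r t 1) (volume.restrict (Ioi 0)) :=
  integrableOn_rpowIntegrand₀₁_Ioi hr zero_le_one

theorem weight_nonneg (hr : r ∈ Ioo 0 1) {t : ℝ} (ht : 0 < t) : 0 ≤ rpowIntegrand₀₁ r t 1 :=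
  rpowIntegrand₀₁_nonneg hr.1 ht.le zero_le_one

/-- A bounded measurable function is integrable against the weight. -/
theorem integrable_weight_smul {E : Type*} [NormedAddCommGroup E] [NormedSpace ℝ E]
    (hr : r ∈ Ioo 0 1) {f : ℝ → E} (hf : ContinuousOn f (Ioi 0)) {M : ℝ}
    (hM : ∀ t > 0, ‖f t‖ ≤ M) :
    Integrable (fun t => rpowIntegrand₀₁ r t 1 • f t) (volume.restrict (Ioi 0)) := by
  refine (integrable_weight hr).smul_bdd M (hf.aestronglyMeasurable measurableSet_Ioi) ?_
  filter_upwards [ae_restrict_mem measurableSet_Ioi] with t ht using hM t ht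

theorem differentiableOn_integral_powKernel (hr : r ∈ Ioo 0 1) :
    DifferentiableOn ℂ (fun z => ∫ t in Ioi 0, rpowIntegrand₀₁ r t 1 • powKernel t z)
      {z | 0 < z.re} := by
  intro z hz
  have hz : 0 < z.re := hz
  have hδ : 0 < z.re / 2 := by linarith
  -- On this half plane the derivative of the kernel is bounded uniformly in `w` and `t`, as
  -- differentiation under the integral requires.
  have hU : {w : ℂ | z.re / 2 < w.re} ∈ 𝓝 z :=
    (isOpen_lt continuous_const Complex.continuous_re).mem_nhds (by simp; linarith)
  have hcont : ∀ w : ℂ, 0 < w.re → ContinuousOn (fun t => powKernel t w) (Ioi 0) := fun w hw =>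
    continuousOn_powKernel.comp (f := fun t : ℝ => (t, w)) (by fun_prop)
      fun t ht => ⟨le_of_lt (mem_Ioi.1 ht), hw⟩
  have := hasDerivAt_integral_of_dominated_loc_of_deriv_le (μ := volume.restrict (Ioi (0 : ℝ)))
    (F := fun z t => rpowIntegrand₀₁ r t 1 • powKernel t z)
    (F' := fun z t => rpowIntegrand₀₁ r t 1 • (((t : ℂ) + 1) * t * ((z + t)⁻¹) ^ 2))
    (bound := fun t => rpowIntegrand₀₁ r t 1 * ((min 1 (z.re / 2))⁻¹ * (min 1 (z.re / 2))⁻¹))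
    hU ?_ ?_ ?_ ?_ ((integrable_weight hr).mul_const _) ?_
  · exact this.2.differentiableAt.differentiableWithinAt
  · filter_upwards [hU] with w hw
    exact (integrable_weight hr).aestronglyMeasurable.smul
      ((hcont w (hδ.trans hw)).aestronglyMeasurable measurableSet_Ioi)
  · exact integrable_weight_smul hr (hcont z hz)
      fun t ht => norm_powKernel_le hz le_rfl (le_of_lt ht)
  · refine (integrable_weight hr).aestronglyMeasurable.smul
      (ContinuousOn.aestronglyMeasurable ?_ measurableSet_Ioi)
    have : ContinuousOn (fun t : ℝ => (z + (t : ℂ))⁻¹) (Ioi 0) :=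
      ContinuousOn.inv₀ (by fun_prop) fun p hp => add_ofReal_ne_zero hz (le_of_lt hp)
    fun_prop
  · filter_upwards [ae_restrict_mem measurableSet_Ioi] with t ht w hw
    rw [norm_smul, Real.norm_of_nonneg (weight_nonneg hr ht)]
    refine mul_le_mul_of_nonneg_left ?_ (weight_nonneg hr ht)
    have e : ((t : ℂ) + 1) * t * ((w + t)⁻¹) ^ 2 =
      (((t : ℂ) + 1) * (w + t)⁻¹) * (t * (w + t)⁻¹) := by ring
    have h1 := norm_add_one_mul_inv_le hδ (le_of_lt hw) (le_of_lt ht)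
    have h2 : ‖(t : ℂ) * (w + t)⁻¹‖ ≤ ‖((t : ℂ) + 1) * (w + t)⁻¹‖ := by
      rw [norm_mul, norm_mul]
      gcongr
      have e1 : (t : ℂ) + 1 = ((t + 1 : ℝ) : ℂ) := by push_cast; rfl
      have ht : 0 < t := ht
      rw [e1, Complex.norm_real, Complex.norm_real, Real.norm_of_nonneg, Real.norm_of_nonneg] <;>
        linarith
    rw [e, norm_mul]
    exact mul_le_mul h1 (h2.trans h1) (norm_nonneg _) (by positivity)
  · filter_upwards [ae_restrict_mem measurableSet_Ioi] with t ht w hw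
    exact (hasDerivAt_powKernel (hδ.trans hw) (le_of_lt ht)).const_smul (rpowIntegrand₀₁ r t 1)

/-- The total mass of the weight `t ^ (r - 1) / (t + 1)`. -/
noncomputable def weightMass (r : ℝ) : ℝ := ∫ t in Ioi 0, rpowIntegrand₀₁ r t 1

theorem weightMass_pos (hr : r ∈ Ioo 0 1) : 0 < weightMass r := integral_rpowIntegrand₀₁_one_pos hr

/-- The Stieltjes representation of the principal power on the right half plane. -/
theorem cpow_eq_integral_powKernel (hr : r ∈ Ioo 0 1) {z : ℂ} (hz : 0 < z.re) :
    z ^ (r : ℂ) =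
      (weightMass r)⁻¹ • ∫ t in Ioi 0, rpowIntegrand₀₁ r t 1 • powKernel t z := by
  have hU : IsOpen {z : ℂ | 0 < z.re} := isOpen_lt continuous_const Complex.continuous_re
  have hconv : IsPreconnected {z : ℂ | 0 < z.re} :=
    (convex_halfSpace_re_gt 0).isPreconnected
  have hf : AnalyticOnNhd ℂ (fun z : ℂ => z ^ (r : ℂ)) {z | 0 < z.re} :=
    DifferentiableOn.analyticOnNhd (fun z hz => ((differentiableAt_id).cpow_const
      (Or.inl hz)).differentiableWithinAt) hU
  have hg : AnalyticOnNhd ℂ (fun z : ℂ => (weightMass r)⁻¹ •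
      ∫ t in Ioi 0, rpowIntegrand₀₁ r t 1 • powKernel t z) {z | 0 < z.re} :=
    ((differentiableOn_integral_powKernel hr).const_smul (weightMass r)⁻¹).analyticOnNhd hU
  -- Both sides are analytic, so agreement at real points accumulating at `1` suffices; there the
  -- integral is the known real formula for `x ^ r`.
  refine hf.eqOn_of_preconnected_of_frequently_eq hg hconv (z₀ := 1) (by simp) ?_ hz
  have ht : Tendsto (fun x : ℝ => (x : ℂ)) (𝓝[≠] 1) (𝓝[≠] 1) := by
    refine tendsto_nhdsWithin_of_tendsto_nhds_of_eventually_within _ ?_ ?_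
    · exact (Complex.continuous_ofReal.tendsto' 1 1 (by simp)).mono_left nhdsWithin_le_nhds
    · filter_upwards [self_mem_nhdsWithin] with x hx
      simpa using hx
  refine ht.frequently (Eventually.frequently ?_)
  filter_upwards [nhdsWithin_le_nhds (lt_mem_nhds zero_lt_one)] with x hx
  have h1 := integral_rpowIntegrand₀₁_eq_rpow_mul_const hr hx.le
  have h2 : ∫ t in Ioi 0, rpowIntegrand₀₁ r t 1 • powKernel t x =
      ((∫ t in Ioi 0, rpowIntegrand₀₁ r t x : ℝ) : ℂ) := by
    rw [← integral_complex_ofReal]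
    refine setIntegral_congr_fun measurableSet_Ioi fun t ht => ?_
    have ht : 0 < t := ht
    rw [powKernel_eq (by simpa using hx) ht.le, rpowIntegrand₀₁_eq_pow_div hr ht.le zero_le_one,
      rpowIntegrand₀₁_eq_pow_div hr ht.le hx.le, Complex.real_smul]
    have h3 : (x : ℂ) + t ≠ 0 := add_ofReal_ne_zero (by simpa using hx) ht.le
    have h4 : (t : ℂ) + 1 ≠ 0 := by
      have : (t : ℂ) + 1 = ((t + 1 : ℝ) : ℂ) := by push_cast; rfl
      rw [this, Complex.ofReal_ne_zero]; positivity
    push_cast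
    rw [add_comm (t : ℂ) x]
    field_simp
  rw [h2, h1, ← Complex.ofReal_cpow hx.le, Complex.real_smul, ← Complex.ofReal_mul]
  congr 1
  have := (weightMass_pos hr).ne'
  unfold weightMass at *
  field_simp

end Scalar

/-! ### Stieltjes representation of the Riesz power. -/

section Operator

open MeasureTheory Real Set Metric

variable {B : Type*} [NormedRing B] [NormedAlgebra ℂ B]

/-- The operator version of `powKernel`, that is, `(t + 1) a (a + t)⁻¹`. -/
noncomputable def powKernelOp (t : ℝ) (a : B) : B :=
  ((t : ℂ) + 1) • (1 - (t : ℂ) • Ring.inverse (a + algebraMap ℂ B t))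

theorem resolvent_neg (a : B) (t : ℂ) :
    resolvent a (-t) = -Ring.inverse (a + algebraMap ℂ B t) := by
  have e : algebraMap ℂ B (-t) - a = -(a + algebraMap ℂ B t) := by rw [map_neg]; abel
  rw [resolvent, e]
  by_cases h : IsUnit (a + algebraMap ℂ B t)
  · obtain ⟨u, hu⟩ := h
    rw [← hu, ← Units.val_neg, Ring.inverse_unit, Ring.inverse_unit, inv_neg, Units.val_neg]
  · rw [Ring.inverse_non_unit _ h, Ring.inverse_non_unit _ (by rwa [IsUnit.neg_iff]), neg_zero]

variable [CompleteSpace B]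

/-- The kernel is affine in `(z + t)⁻¹`, and its pole `-t` lies outside the disc, so the two
preceding resolvent integrals apply. -/
theorem circleIntegral_powKernel_smul_resolvent {a : B} {c : ℂ} {R : ℝ} (hR : 0 < R)
    (h : spectrum ℂ a ⊆ ball c R) (hre : ∀ z ∈ closedBall c R, 0 < z.re) {t : ℝ} (ht : 0 ≤ t) :
    ∮ z in C(c, R), powKernel t z • resolvent a z =
      (2 * (π : ℂ) * Complex.I) • powKernelOp t a := by
  have hs : -(t : ℂ) ∉ closedBall c R := fun h' => by
    have := hre _ h'
    simp at this; linarith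
  have hne : ∀ z ∈ sphere c R, z - (-(t : ℂ)) ≠ 0 := fun z hz => by
    rw [sub_neg_eq_add]; exact add_ofReal_ne_zero (hre z (sphere_subset_closedBall hz)) ht
  have hi1 : CircleIntegrable (resolvent a) c R := by
    simpa using circleIntegrable_smul_resolvent hR.le h (f := fun _ => 1) continuousOn_const
  have hi2 : CircleIntegrable (fun z => (t : ℂ) • ((z - (-(t : ℂ)))⁻¹ • resolvent a z)) c R := by
    simp only [smul_smul]
    refine circleIntegrable_smul_resolvent hR.le h (f := fun z => (t : ℂ) * (z - (-(t : ℂ)))⁻¹) ?_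
    exact continuousOn_const.mul ((continuousOn_id.sub continuousOn_const).inv₀ hne)
  have e : ∀ z, powKernel t z • resolvent a z = ((t : ℂ) + 1) •
      (resolvent a z - (t : ℂ) • ((z - (-(t : ℂ)))⁻¹ • resolvent a z)) := fun z => by
    rw [powKernel, sub_neg_eq_add, mul_smul, sub_smul, one_smul, mul_smul]
  simp only [e]
  rw [circleIntegral.integral_smul, circleIntegral.integral_sub hi1 hi2,
    circleIntegral.integral_smul, circleIntegral_resolvent hR h,
    circleIntegral_inv_smul_resolvent hR h hs, resolvent_neg, powKernelOp]
  module

/-- The Riesz functional calculus at the principal power `z ^ r`, `0 < r < 1`, agrees with the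
Stieltjes integral. -/
theorem circleIntegral_cpow_smul_resolvent {r : ℝ} (hr : r ∈ Ioo 0 1) {a : B} {c : ℂ} {R δ : ℝ}
    (hR : 0 < R) (h : spectrum ℂ a ⊆ ball c R) (hδ : 0 < δ)
    (hre : ∀ z ∈ closedBall c R, δ ≤ z.re) :
    ∮ z in C(c, R), (z ^ (r : ℂ)) • resolvent a z = (2 * (π : ℂ) * Complex.I) •
      (weightMass r)⁻¹ • ∫ t in Ioi 0, rpowIntegrand₀₁ r t 1 • powKernelOp t a := by
  have hsph : ∀ θ, circleMap c R θ ∈ sphere c R := circleMap_mem_sphere c hR.le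
  have hre' : ∀ θ, δ ≤ (circleMap c R θ).re := fun θ => hre _ (sphere_subset_closedBall (hsph θ))
  have hre0 : ∀ θ, 0 < (circleMap c R θ).re := fun θ => hδ.trans_le (hre' θ)
  set H : ℝ → ℝ → B := fun θ t => deriv (circleMap c R) θ •
    (powKernel t (circleMap c R θ) • resolvent a (circleMap c R θ)) with hH
  have hHc : ContinuousOn (Function.uncurry H) (univ ×ˢ Ioi 0) := by
    have h1 : ContinuousOn (fun p : ℝ × ℝ => deriv (circleMap c R) p.1) (univ ×ˢ Ioi 0) := by
      simp only [deriv_circleMap]; fun_prop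
    have h2 : ContinuousOn (fun p : ℝ × ℝ => powKernel p.2 (circleMap c R p.1))
        (univ ×ˢ Ioi 0) :=
      continuousOn_powKernel.comp (f := fun p : ℝ × ℝ => (p.2, circleMap c R p.1)) (by fun_prop)
        fun p hp => ⟨le_of_lt (mem_Ioi.1 hp.2), hre0 _⟩
    have h3 : ContinuousOn (fun p : ℝ × ℝ => resolvent a (circleMap c R p.1)) (univ ×ˢ Ioi 0) :=
      (continuousOn_resolvent a).comp (f := fun p : ℝ × ℝ => circleMap c R p.1) (by fun_prop)
        fun p _ => sphere_subset_resolventSet h (hsph _)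
    exact h1.smul (h2.smul h3)
  -- A bound uniform in both variables, together with the integrable weight, justifies exchanging
  -- the contour and Stieltjes integrals.
  obtain ⟨M, hM⟩ : ∃ M, ∀ θ, ∀ t > 0, ‖H θ t‖ ≤ M := by
    obtain ⟨M, hM⟩ := (isCompact_sphere c R).exists_bound_of_continuousOn
      ((continuousOn_resolvent a).mono (sphere_subset_resolventSet h))
    refine ⟨R * (((‖c‖ + R) * (min 1 δ)⁻¹) * M), fun θ t ht => ?_⟩
    have h1 : ‖circleMap c R θ‖ ≤ ‖c‖ + R := by
      have := hsph θ
      rw [mem_sphere, dist_eq_norm] at this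
      have h2 := norm_add_le c (circleMap c R θ - c)
      rw [this] at h2
      rwa [add_sub_cancel] at h2
    have hm : 0 < min 1 δ := lt_min one_pos hδ
    rw [hH, norm_smul, norm_smul]
    have hd : ‖deriv (circleMap c R) θ‖ = R := by simp [hR.le]
    rw [hd]
    gcongr
    · exact (norm_powKernel_le hδ (hre' θ) ht.le).trans (by gcongr)
    · exact hM _ (hsph θ)
  have : IsFiniteMeasure (volume.restrict (uIoc 0 (2 * π))) :=
    ⟨by rw [Measure.restrict_apply_univ, uIoc]; exact measure_Ioc_lt_top⟩
  have hint : Integrable (Function.uncurry fun θ t => rpowIntegrand₀₁ r t 1 • H θ t)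
      ((volume.restrict (uIoc 0 (2 * π))).prod (volume.restrict (Ioi 0))) := by
    have hw : Integrable (fun p : ℝ × ℝ => rpowIntegrand₀₁ r p.2 1 * M)
        ((volume.restrict (uIoc 0 (2 * π))).prod (volume.restrict (Ioi 0))) :=
      ((integrable_weight hr).comp_snd _).mul_const M
    have hmem : ∀ᵐ p : ℝ × ℝ ∂((volume.restrict (uIoc 0 (2 * π))).prod
        (volume.restrict (Ioi 0))), p ∈ uIoc 0 (2 * π) ×ˢ Ioi 0 := by
      rw [Measure.prod_restrict]
      exact ae_restrict_mem (measurableSet_uIoc.prod measurableSet_Ioi)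
    refine hw.mono' (AEStronglyMeasurable.smul (f := fun p : ℝ × ℝ => rpowIntegrand₀₁ r p.2 1)
      ((integrable_weight hr).comp_snd _).aestronglyMeasurable ?_) ?_
    · rw [Measure.prod_restrict]
      exact (hHc.mono (prod_mono_left (subset_univ _))).aestronglyMeasurable
        (measurableSet_uIoc.prod measurableSet_Ioi)
    · filter_upwards [hmem] with p hp
      rw [Function.uncurry, norm_smul, Real.norm_of_nonneg (weight_nonneg hr hp.2)]
      exact mul_le_mul_of_nonneg_left (hM _ _ hp.2) (weight_nonneg hr hp.2)
  have e : ∀ θ, deriv (circleMap c R) θ • ((circleMap c R θ) ^ (r : ℂ)) •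
      resolvent a (circleMap c R θ) =
      (weightMass r)⁻¹ • ∫ t in Ioi 0, rpowIntegrand₀₁ r t 1 • H θ t := fun θ => by
    have : ∀ t, rpowIntegrand₀₁ r t 1 • H θ t = deriv (circleMap c R) θ •
        ((rpowIntegrand₀₁ r t 1 • powKernel t (circleMap c R θ)) •
          resolvent a (circleMap c R θ)) := fun t => by
      rw [hH, smul_comm, smul_assoc]
    simp only [this]
    rw [integral_smul, integral_smul_const, cpow_eq_integral_powKernel hr (hre0 θ), smul_assoc,
      smul_comm (weightMass r)⁻¹ (deriv (circleMap c R) θ)]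
  have e2 : ∀ t ∈ Ioi (0 : ℝ), ∫ θ in (0)..(2 * π), rpowIntegrand₀₁ r t 1 • H θ t =
      (2 * (π : ℂ) * Complex.I) • (rpowIntegrand₀₁ r t 1 • powKernelOp t a) := fun t ht => by
    rw [intervalIntegral.integral_smul, smul_comm, ← circleIntegral_powKernel_smul_resolvent hR h
      (fun z hz => hδ.trans_le (hre z hz)) (le_of_lt ht), circleIntegral]
  rw [circleIntegral]
  simp only [e]
  rw [intervalIntegral.integral_smul, intervalIntegral_integral_swap hint,
    setIntegral_congr_fun measurableSet_Ioi e2, integral_smul, smul_comm]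

end Operator

/-! ### Norm estimates from the numerical range. -/

section Accretive

open Set

variable {B : Type*} [NormedRing B] [NormedAlgebra ℂ B]

/-- If the numerical range of `x` lies in the closed right half plane, then `x + z` is bounded
below by `Re z`. -/
theorem re_mul_norm_le [NormOneClass B] {x : B} (hx : numRange x ⊆ {w : ℂ | 0 ≤ w.re}) (z : ℂ)
    (b : B) : z.re * ‖b‖ ≤ ‖(x + algebraMap ℂ B z) * b‖ := by
  rcases eq_or_ne b 0 with rfl | hb
  · simp
  obtain ⟨g, hg, hgb⟩ := exists_dual_vector ℂ b (by simpa using hb)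
  have hb0 : 0 < ‖b‖ := norm_pos_iff.2 hb
  have hbc : (‖b‖ : ℂ) ≠ 0 := by exact_mod_cast hb0.ne'
  -- With `g` norming `b`, the functional `c ↦ g (c * b) / ‖b‖` is a state.
  set φ : B →L[ℂ] ℂ := (‖b‖ : ℂ)⁻¹ • g.comp ((ContinuousLinearMap.mul ℂ B).flip b) with hφ
  have hφa : ∀ c, φ c = (‖b‖ : ℂ)⁻¹ * g (c * b) := fun c => by simp [hφ]
  have hφ1 : φ 1 = 1 := by
    rw [hφa, one_mul, hgb]; exact inv_mul_cancel₀ hbc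
  have hn : ‖φ‖ = 1 := by
    refine le_antisymm (φ.opNorm_le_bound zero_le_one fun c => ?_) ?_
    · rw [hφa, norm_mul, norm_inv, Complex.norm_real, norm_norm, inv_mul_le_iff₀ hb0, one_mul]
      calc _ ≤ ‖g‖ * ‖c * b‖ := g.le_opNorm _
        _ ≤ ‖b‖ * ‖c‖ := by rw [hg, one_mul, mul_comm]; exact norm_mul_le _ _
    · have := φ.le_opNorm 1
      rwa [hφ1, norm_one, norm_one, mul_one] at this
  have hre : 0 ≤ (φ x).re := hx ⟨φ, hn, hφ1, rfl⟩
  have e : φ (x + algebraMap ℂ B z) = φ x + z := by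
    rw [map_add, Algebra.algebraMap_eq_smul_one, map_smul, hφ1, smul_eq_mul, mul_one]
  have h1 : z.re ≤ ‖φ (x + algebraMap ℂ B z)‖ := by
    rw [e]
    refine le_trans ?_ (Complex.re_le_norm _)
    rw [Complex.add_re]; linarith
  have h2 := g.le_opNorm ((x + algebraMap ℂ B z) * b)
  rw [hg, one_mul] at h2
  refine le_trans ?_ h2
  rw [hφa, norm_mul, norm_inv, Complex.norm_real, norm_norm, inv_mul_eq_div, le_div_iff₀ hb0] at h1
  exact h1

/-- Apply the lower bound to `b = s - x`, using `(x + s) (s - x) = s² - x²`. The excess over `s`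
vanishes as `s → ∞`, which later makes a Neumann series converge. -/
theorem norm_algebraMap_sub_le [NormOneClass B] {x : B}
    (hx : numRange x ⊆ {w : ℂ | 0 ≤ w.re}) {s : ℝ} (hs : 0 < s) :
    ‖algebraMap ℂ B s - x‖ ≤ s + ‖x‖ ^ 2 / s := by
  have h := re_mul_norm_le hx s (algebraMap ℂ B s - x)
  have e : (x + algebraMap ℂ B s) * (algebraMap ℂ B s - x) = algebraMap ℂ B (s ^ 2) - x ^ 2 := by
    rw [map_pow, add_mul, mul_sub, mul_sub, ← Algebra.commutes (s : ℂ) x, sq, sq]; abel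
  rw [e, Complex.ofReal_re] at h
  have h2 : ‖algebraMap ℂ B ((s : ℂ) ^ 2) - x ^ 2‖ ≤ s ^ 2 + ‖x‖ ^ 2 := by
    refine (norm_sub_le _ _).trans (add_le_add ?_ (norm_pow_le x 2))
    rw [norm_algebraMap']; simp
  have e2 : s + ‖x‖ ^ 2 / s = (s ^ 2 + ‖x‖ ^ 2) / s := by field_simp
  rw [e2, le_div_iff₀ hs, mul_comm]
  exact h.trans h2

end Accretive

/-! ### Resolvents computed inside the nonunital algebra. -/

section QuasiResolvent

open Set

variable {A : Type*} [NonUnitalNormedRing A] [NormedSpace ℂ A]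

/-- `q z` plays the role of `x (x + z)⁻¹` for `z` in the open right half plane, with a bound on
the positive half line. -/
structure IsQuasiResolvent (x : A) (q : ℂ → A) : Prop where
  left : ∀ z : ℂ, 0 < z.re → z • q z + x * q z = x
  right : ∀ z : ℂ, 0 < z.re → z • q z + q z * x = x
  norm_le : ∀ t : ℝ, 0 < t → ‖q t‖ ≤ 2

variable {B : Type*} [NormedRing B] [NormedAlgebra ℂ B] {ι : A →ₙₐ[ℂ] B}

namespace IsQuasiResolvent

variable {x : A} {q : ℂ → A}

/-- The formula `(x + z)⁻¹ = z⁻¹ (1 - x (x + z)⁻¹)` needs only identities in `A`; neither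
accretivity of `ι x` in this `B` nor isometry of `ι` enters. -/
theorem mul_inverse (hq : IsQuasiResolvent x q) (ι : A →ₙₐ[ℂ] B) {z : ℂ} (hz : 0 < z.re) :
    (ι x + algebraMap ℂ B z) * (z⁻¹ • (1 - ι (q z))) = 1 := by
  have hz0 : z ≠ 0 := by rintro rfl; simp at hz
  have h : z • ι (q z) + ι x * ι (q z) = ι x := by
    rw [← map_smul, ← map_mul, ← map_add, hq.left z hz]
  rw [mul_smul_comm, inv_smul_eq_iff₀ hz0, add_mul, ← Algebra.smul_def, mul_sub, mul_one, smul_sub]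
  nth_rw 1 [← h]
  abel

theorem inverse_mul (hq : IsQuasiResolvent x q) (ι : A →ₙₐ[ℂ] B) {z : ℂ} (hz : 0 < z.re) :
    (z⁻¹ • (1 - ι (q z))) * (ι x + algebraMap ℂ B z) = 1 := by
  have hz0 : z ≠ 0 := by rintro rfl; simp at hz
  have h : z • ι (q z) + ι (q z) * ι x = ι x := by
    rw [← map_smul, ← map_mul, ← map_add, hq.right z hz]
  rw [smul_mul_assoc, inv_smul_eq_iff₀ hz0, mul_add, ← Algebra.commutes, ← Algebra.smul_def,
    sub_mul, one_mul, smul_sub]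
  nth_rw 1 [← h]
  abel

theorem isUnit (hq : IsQuasiResolvent x q) (ι : A →ₙₐ[ℂ] B) {z : ℂ} (hz : 0 < z.re) :
    IsUnit (ι x + algebraMap ℂ B z) :=
  ⟨⟨_, _, hq.mul_inverse ι hz, hq.inverse_mul ι hz⟩, rfl⟩

theorem inverse_eq (hq : IsQuasiResolvent x q) (ι : A →ₙₐ[ℂ] B) {z : ℂ} (hz : 0 < z.re) :
    Ring.inverse (ι x + algebraMap ℂ B z) = z⁻¹ • (1 - ι (q z)) :=
  Ring.inverse_unit ⟨_, _, hq.mul_inverse ι hz, hq.inverse_mul ι hz⟩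

theorem map_eq (hq : IsQuasiResolvent x q) (ι : A →ₙₐ[ℂ] B) {z : ℂ} (hz : 0 < z.re) :
    ι (q z) = 1 - z • Ring.inverse (ι x + algebraMap ℂ B z) := by
  have hz0 : z ≠ 0 := by rintro rfl; simp at hz
  rw [hq.inverse_eq ι hz, smul_inv_smul₀ hz0, sub_sub_cancel]

theorem norm_add_one_smul_le (hq : IsQuasiResolvent x q) {t : ℝ} (ht : 0 < t) :
    ‖((t : ℂ) + 1) • q t‖ ≤ 3 * ‖x‖ + 2 := by
  have h := hq.left t (by simpa using ht)
  have e : ((t : ℂ) + 1) • q t = x - x * q t + q t := by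
    rw [add_smul, one_smul, ← eq_sub_of_add_eq h]
  have h2 := hq.norm_le t ht
  rw [e]
  calc _ ≤ ‖x‖ + ‖x‖ * ‖q t‖ + ‖q t‖ :=
        (norm_add_le _ _).trans (add_le_add_left ((norm_sub_le _ _).trans
          (add_le_add_right (norm_mul_le _ _) _)) _)
    _ ≤ _ := by nlinarith [norm_nonneg x]

theorem powKernelOp_eq (hq : IsQuasiResolvent x q) (ι : A →ₙₐ[ℂ] B) {t : ℝ} (ht : 0 < t) :
    powKernelOp t (ι x) = ι (((t : ℂ) + 1) • q t) := by
  rw [powKernelOp, map_smul, hq.map_eq ι (by simpa using ht)]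

end IsQuasiResolvent

theorem norm_map_eq (hι : Isometry ι) (a : A) : ‖ι a‖ = ‖a‖ :=
  hι.norm_map_of_map_zero (map_zero ι) a

theorem continuous_clm (hι : Isometry ι) : ∃ L : A →L[ℂ] B, ∀ a, L a = ι a :=
  ⟨⟨(ι : A →ₗ[ℂ] B), hι.continuous⟩, fun _ => rfl⟩

variable [NormOneClass B]

theorem norm_inverse_le {x : B} (hx : numRange x ⊆ {w : ℂ | 0 ≤ w.re}) {z : ℂ}
    {p : B} (hp : (x + algebraMap ℂ B z) * p = 1) : z.re * ‖p‖ ≤ 1 := by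
  have := re_mul_norm_le hx z p
  rwa [hp, norm_one] at this

variable [CompleteSpace A] [CompleteSpace B]

/-- Write `x + z = d (1 - D)` with `d = z + s` and `D = d⁻¹ (s - x)`, and invert by the Neumann
series. Each `x D ^ n` lies in the image of `A`, and completeness of `A` keeps the sum there. -/
theorem exists_map_eq_mul_inverse (hι : Isometry ι) {x : A} (hx : x ∈ realPosIn ι) {z : ℂ}
    (hz : 0 < z.re) : ∃ (q : A) (p : B), ι q = ι x * p ∧
      (ι x + algebraMap ℂ B z) * p = 1 ∧ p * (ι x + algebraMap ℂ B z) = 1 := by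
  -- This gives `‖s - x‖ ≤ s + ‖x‖² / s < s + Re z ≤ ‖d‖`, hence `‖D‖ < 1`.
  obtain ⟨s, hs, hsz⟩ : ∃ s : ℝ, 0 < s ∧ ‖ι x‖ ^ 2 / s < z.re := by
    refine ⟨‖ι x‖ ^ 2 / z.re + 1, by positivity, ?_⟩
    rw [div_lt_iff₀ (by positivity), mul_add, mul_div_cancel₀ _ hz.ne']
    linarith
  set d : ℂ := z + s with hd
  have hdn : s + z.re ≤ ‖d‖ := by
    refine le_trans ?_ (Complex.re_le_norm _)
    simp [hd, add_comm]
  have hd0 : 0 < ‖d‖ := lt_of_lt_of_le (by linarith) hdn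
  have hdne : d ≠ 0 := norm_pos_iff.1 hd0
  set D : B := d⁻¹ • (algebraMap ℂ B s - ι x) with hD
  have hD1 : ‖D‖ < 1 := by
    rw [hD, norm_smul, norm_inv, inv_mul_lt_iff₀ hd0, mul_one]
    have := norm_algebraMap_sub_le hx hs
    linarith
  have hrange : ∀ n : ℕ, ∃ a : A, ι a = ι x * D ^ n := by
    intro n
    induction n with
    | zero => exact ⟨x, by simp⟩
    | succ n ih =>
      obtain ⟨a, ha⟩ := ih
      refine ⟨d⁻¹ • ((s : ℂ) • a - a * x), ?_⟩
      rw [pow_succ, ← mul_assoc, ← ha, map_smul, map_sub, map_smul, map_mul, hD, mul_smul_comm,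
        mul_sub, ← Algebra.commutes, ← Algebra.smul_def]
  choose a ha using hrange
  have hsD : Summable fun n : ℕ => D ^ n := summable_geometric_of_norm_lt_one hD1
  have hsa : Summable a := by
    refine Summable.of_norm_bounded (g := fun n => ‖ι x‖ * ‖D‖ ^ n)
      ((summable_geometric_of_lt_one (norm_nonneg _) hD1).mul_left _) fun n => ?_
    rw [← norm_map_eq hι, ha]
    exact (norm_mul_le _ _).trans (mul_le_mul_of_nonneg_left (norm_pow_le _ _) (norm_nonneg _))
  have hdD : ι x + algebraMap ℂ B z = d • (1 - D) := by
    rw [hD, smul_sub, smul_inv_smul₀ hdne, ← Algebra.algebraMap_eq_smul_one, hd, map_add]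
    abel
  obtain ⟨L, hL⟩ := continuous_clm hι
  refine ⟨d⁻¹ • ∑' n, a n, d⁻¹ • ∑' n, D ^ n, ?_, ?_, ?_⟩
  · rw [map_smul, mul_smul_comm, ← hL, L.map_tsum hsa, ← hsD.tsum_mul_left]
    simp only [hL, ha]
  · rw [hdD, smul_mul_smul_comm, mul_inv_cancel₀ hdne, one_smul, mul_neg_geom_series D hD1]
  · rw [hdD, smul_mul_smul_comm, inv_mul_cancel₀ hdne, one_smul, geom_series_mul_neg D hD1]

theorem exists_isQuasiResolvent (hι : Isometry ι) {x : A} (hx : x ∈ realPosIn ι) :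
    ∃ q, IsQuasiResolvent x q := by
  have h : ∀ z : ℂ, ∃ q : A, 0 < z.re → ∃ p : B, ι q = ι x * p ∧
      (ι x + algebraMap ℂ B z) * p = 1 ∧ p * (ι x + algebraMap ℂ B z) = 1 := fun z => by
    by_cases hz : 0 < z.re
    · obtain ⟨q, p, h⟩ := exists_map_eq_mul_inverse hι hx hz
      exact ⟨q, fun _ => ⟨p, h⟩⟩
    · exact ⟨0, fun h => absurd h hz⟩
  choose q hq using h
  refine ⟨q, fun z hz => ?_, fun z hz => ?_, fun t ht => ?_⟩
  · obtain ⟨p, h1, h2, h3⟩ := hq z hz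
    apply hι.injective
    rw [map_add, map_smul, map_mul, h1, Algebra.smul_def, ← mul_assoc, Algebra.commutes, mul_assoc,
      ← mul_add, ← add_mul, add_comm (algebraMap ℂ B z), h2, mul_one]
  · obtain ⟨p, h1, h2, h3⟩ := hq z hz
    apply hι.injective
    rw [map_add, map_smul, map_mul, h1, Algebra.smul_def, ← mul_assoc, Algebra.commutes, mul_assoc,
      mul_assoc, ← mul_add, Algebra.commutes, ← mul_add, add_comm (algebraMap ℂ B z), h3, mul_one]
  · obtain ⟨p, h1, h2, h3⟩ := hq t (by simpa using ht)
    have hp := norm_inverse_le hx h2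
    have e : ι x * p = 1 - (t : ℂ) • p := by
      rw [← h2, add_mul, Algebra.smul_def]; abel
    rw [← norm_map_eq hι, h1, e]
    refine (norm_sub_le _ _).trans ?_
    rw [norm_one, norm_smul, Complex.norm_real, Real.norm_of_nonneg ht.le]
    rw [Complex.ofReal_re] at hp
    linarith

end QuasiResolvent

/-! ### Riesz powers of the shifts `a + ε`, and the exponents `0` and `1`. -/

section RieszPow

open MeasureTheory Real Set Metric

variable {B : Type*} [NormedRing B] [NormedAlgebra ℂ B] [CompleteSpace B]

theorem continuousAt_inverse_add {a : B} {z : ℂ} (hu : IsUnit (a + algebraMap ℂ B z)) :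
    ContinuousAt (fun w : ℂ => Ring.inverse (a + algebraMap ℂ B w)) z := by
  obtain ⟨u, hu⟩ := hu
  have h1 : ContinuousAt Ring.inverse (a + algebraMap ℂ B z) :=
    hu ▸ NormedRing.inverse_continuousAt u
  exact ContinuousAt.comp (f := fun w : ℂ => a + algebraMap ℂ B w) h1
    (continuous_const.add (algebraMapCLM ℂ B).continuous).continuousAt

theorem continuousOn_inverse_add {a : B}
    (ha : ∀ z : ℂ, 0 < z.re → IsUnit (a + algebraMap ℂ B z)) {ε : ℝ} (hε : 0 ≤ ε) :
    ContinuousOn (fun t : ℝ => Ring.inverse (a + algebraMap ℂ B ε + algebraMap ℂ B t)) (Ioi 0) := by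
  intro t ht
  have ht : 0 < t := ht
  have hu := ha ((ε + t : ℝ) : ℂ) (by rw [Complex.ofReal_re]; linarith)
  have h2 : ContinuousAt (fun t : ℝ => ((ε + t : ℝ) : ℂ)) t := by fun_prop
  have := ContinuousAt.comp (f := fun t : ℝ => ((ε + t : ℝ) : ℂ)) (continuousAt_inverse_add hu) h2
  refine ContinuousAt.continuousWithinAt (this.congr (Eventually.of_forall fun s => ?_))
  simp only [Function.comp_apply, Complex.ofReal_add, map_add, add_assoc]

theorem continuousOn_powKernelOp {a : B}
    (ha : ∀ z : ℂ, 0 < z.re → IsUnit (a + algebraMap ℂ B z)) {ε : ℝ} (hε : 0 ≤ ε) :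
    ContinuousOn (fun t : ℝ => powKernelOp t (a + algebraMap ℂ B ε)) (Ioi 0) := by
  unfold powKernelOp
  have h := continuousOn_inverse_add ha hε
  have h1 : ContinuousOn (fun t : ℝ => (t : ℂ)) (Ioi 0) := Complex.continuous_ofReal.continuousOn
  exact (h1.add continuousOn_const).smul (continuousOn_const.sub (h1.smul h))

theorem tendsto_powKernelOp {a : B} {t : ℝ} (hu : IsUnit (a + algebraMap ℂ B t)) :
    Tendsto (fun ε : ℝ => powKernelOp t (a + algebraMap ℂ B ε)) (𝓝[>] 0)
      (𝓝 (powKernelOp t a)) := by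
  have h2 : Tendsto (fun ε : ℝ => ((ε + t : ℝ) : ℂ)) (𝓝[>] 0) (𝓝 (t : ℂ)) :=
    (Continuous.tendsto' (by fun_prop) 0 _ (by simp)).mono_left nhdsWithin_le_nhds
  have := (continuousAt_inverse_add hu).tendsto.comp h2
  unfold powKernelOp
  refine (((this.congr fun ε => ?_).const_smul (t : ℂ)).const_sub 1).const_smul _
  simp only [Function.comp_apply, Complex.ofReal_add, map_add, add_assoc]

variable [NormOneClass B]

/-- If the spectrum of `a` lies in the closed right half plane, then that of `a + ε` can be
enclosed in a circle in the open right half plane. -/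
theorem exists_circle {a : B} (ha : ∀ z : ℂ, 0 < z.re → IsUnit (a + algebraMap ℂ B z)) {ε : ℝ}
    (hε : 0 < ε) : ∃ (c : ℂ) (R δ : ℝ), 0 < R ∧ 0 < δ ∧ (∀ z ∈ closedBall c R, δ ≤ z.re) ∧
      spectrum ℂ (a + algebraMap ℂ B ε) ⊆ ball c R := by
  set M := ‖a + algebraMap ℂ B ε‖ with hM
  -- The disc with centre `R + ε / 2` and radius `R` has leftmost point `ε / 2`; this size of `R`
  -- makes it contain every `z` with `Re z ≥ ε` and `‖z‖ ≤ M`.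
  obtain ⟨R, hR0, hR⟩ : ∃ R : ℝ, 0 < R ∧ M ^ 2 < R * ε :=
    ⟨(M ^ 2 + 1) / ε, by positivity, by rw [div_mul_cancel₀ _ hε.ne']; linarith⟩
  refine ⟨((R + ε / 2 : ℝ) : ℂ), R, ε / 2, hR0, by positivity, fun z hz => ?_, fun z hz => ?_⟩
  · rw [mem_closedBall, dist_eq_norm] at hz
    have h1 := (abs_le.1 ((Complex.abs_re_le_norm _).trans hz)).1
    rw [Complex.sub_re, Complex.ofReal_re] at h1
    linarith
  · have h1 : ε ≤ z.re := by
      by_contra hlt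
      refine hz ?_
      have := ha (ε - z) (by simpa using hlt)
      rw [spectrum.mem_resolventSet_iff, ← IsUnit.neg_iff]
      convert! this using 1
      rw [map_sub]; abel
    have h2 : ‖z‖ ≤ M := spectrum.norm_le_norm_of_mem hz
    rw [mem_ball, dist_eq_norm]
    refine lt_of_pow_lt_pow_left₀ 2 hR0.le ?_
    have h3 : ‖z‖ ^ 2 ≤ M ^ 2 := pow_le_pow_left₀ (norm_nonneg _) h2 2
    rw [Complex.sq_norm, Complex.normSq_apply] at h3 ⊢
    simp only [Complex.sub_re, Complex.sub_im, Complex.ofReal_re, Complex.ofReal_im, sub_zero]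
    nlinarith

theorem isRieszPow_of_exists {a : B} (ha : ∀ z : ℂ, 0 < z.re → IsUnit (a + algebraMap ℂ B z))
    {ε : ℝ} (hε : 0 < ε) {r : ℝ} {b : B}
    (h : ∀ (c : ℂ) (R δ : ℝ), 0 < R → 0 < δ → (∀ z ∈ closedBall c R, δ ≤ z.re) →
      spectrum ℂ (a + algebraMap ℂ B ε) ⊆ ball c R →
      ∮ z in C(c, R), (z ^ (r : ℂ)) • resolvent (a + algebraMap ℂ B ε) z =
        (2 * (π : ℂ) * Complex.I) • b) :
    IsRieszPow r (a + algebraMap ℂ B ε) b := by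
  obtain ⟨c, R, δ, hR, hδ, hre, hs⟩ := exists_circle ha hε
  refine ⟨c, R, hR, fun z hz => Or.inl (hδ.trans_le (hre z hz)), hs, ?_⟩
  rw [h c R δ hR hδ hre hs, inv_smul_smul₀ Complex.two_pi_I_ne_zero]

theorem isRieszPow_zero {a : B} (ha : ∀ z : ℂ, 0 < z.re → IsUnit (a + algebraMap ℂ B z))
    {ε : ℝ} (hε : 0 < ε) : IsRieszPow 0 (a + algebraMap ℂ B ε) 1 :=
  isRieszPow_of_exists ha hε fun c R δ hR _ _ hs => by
    simpa using circleIntegral_resolvent hR hs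

theorem isRieszPow_one {a : B} (ha : ∀ z : ℂ, 0 < z.re → IsUnit (a + algebraMap ℂ B z))
    {ε : ℝ} (hε : 0 < ε) :
    IsRieszPow 1 (a + algebraMap ℂ B ε) (a + algebraMap ℂ B ε) :=
  isRieszPow_of_exists ha hε fun c R δ hR _ _ hs => by
    simpa using circleIntegral_smul_id_resolvent hR hs

theorem isRieszPow_integral {a : B} (ha : ∀ z : ℂ, 0 < z.re → IsUnit (a + algebraMap ℂ B z))
    {ε : ℝ} (hε : 0 < ε) {r : ℝ} (hr : r ∈ Ioo 0 1) :
    IsRieszPow r (a + algebraMap ℂ B ε) ((weightMass r)⁻¹ •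
      ∫ t in Ioi 0, rpowIntegrand₀₁ r t 1 • powKernelOp t (a + algebraMap ℂ B ε)) :=
  isRieszPow_of_exists ha hε fun _ _ _ hR hδ hre hs =>
    circleIntegral_cpow_smul_resolvent hr hR hs hδ hre

theorem isPrincipalPow_zero {a : B} (ha : ∀ z : ℂ, 0 < z.re → IsUnit (a + algebraMap ℂ B z)) :
    IsPrincipalPow 0 a 1 :=
  ⟨fun _ => 1, fun _ hε => isRieszPow_zero ha hε, tendsto_const_nhds⟩

theorem isPrincipalPow_one {a : B} (ha : ∀ z : ℂ, 0 < z.re → IsUnit (a + algebraMap ℂ B z)) :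
    IsPrincipalPow 1 a a := by
  refine ⟨fun ε => a + algebraMap ℂ B ε, fun _ hε => isRieszPow_one ha hε, ?_⟩
  have : Continuous fun ε : ℝ => a + algebraMap ℂ B ε :=
    continuous_const.add ((algebraMapCLM ℂ B).continuous.comp Complex.continuous_ofReal)
  exact (this.tendsto' 0 a (by simp)).mono_left nhdsWithin_le_nhds

end RieszPow

/-! ### The power as an integral in `A`: convergence and positivity. -/

section QuasiPow

open MeasureTheory Real Set

variable {A : Type*} [NonUnitalNormedRing A] [NormedSpace ℂ A]

/-- The Stieltjes integral for the principal power `x ^ r`, computed inside `A` from a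
quasi-resolvent of `x`. -/
noncomputable def quasiPow (r : ℝ) (q : ℂ → A) : A :=
  (weightMass r)⁻¹ • ∫ t in Ioi (0 : ℝ), rpowIntegrand₀₁ r t 1 • (((t : ℂ) + 1) • q t)

variable {B : Type*} [NormedRing B] [NormedAlgebra ℂ B] {ι : A →ₙₐ[ℂ] B} {x : A} {q : ℂ → A}
  {r : ℝ}

namespace IsQuasiResolvent

/-- With `s = ε + t`, the kernel at `x + ε` combines `1` and `(s + 1) q s` with coefficients in `[0,
1]`; the first coefficient needs `ε ≤ 1`. The bound dominates the integrands as `ε → 0+`. -/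
theorem norm_powKernelOp_le [NormOneClass B] (hq : IsQuasiResolvent x q) (hι : Isometry ι)
    {ε t : ℝ} (hε : 0 < ε) (hε1 : ε ≤ 1) (ht : 0 < t) : ‖powKernelOp t (ι x + algebraMap ℂ B ε)‖ ≤ 3 * ‖x‖ + 3 := by
  have hs : 0 < ε + t := by positivity
  have hsc : ((ε : ℂ) + t) ≠ 0 := by exact_mod_cast hs.ne'
  have e : powKernelOp t (ι x + algebraMap ℂ B ε) =
      ((((t + 1) * ε / (ε + t) : ℝ)) : ℂ) • (1 : B) +
      (((t + 1) * t / ((ε + t + 1) * (ε + t)) : ℝ) : ℂ) •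
        ι ((((ε + t : ℝ) : ℂ) + 1) • q ((ε + t : ℝ) : ℂ)) := by
    have hsc1 : ((ε : ℂ) + t + 1) ≠ 0 := by
      have : 0 < ε + t + 1 := by positivity
      exact_mod_cast this.ne'
    have h := hq.inverse_eq ι (z := ((ε + t : ℝ) : ℂ)) (by rwa [Complex.ofReal_re])
    rw [powKernelOp, add_assoc, ← map_add, ← Complex.ofReal_add, h, map_smul]
    push_cast
    match_scalars <;> field_simp
    ring
  rw [e]
  have hn := hq.norm_add_one_smul_le hs
  rw [← norm_map_eq hι] at hn
  refine (norm_add_le _ _).trans ?_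
  rw [norm_smul, norm_smul, norm_one, mul_one, Complex.norm_real, Complex.norm_real,
    Real.norm_of_nonneg (by positivity), Real.norm_of_nonneg (by positivity)]
  have h1 : (t + 1) * ε / (ε + t) ≤ 1 := by
    rw [div_le_one hs]; nlinarith
  have h2 : (t + 1) * t / ((ε + t + 1) * (ε + t)) ≤ 1 := by
    rw [div_le_one (by positivity)]; nlinarith
  have h3 := mul_le_of_le_one_left (norm_nonneg (ι ((((ε + t : ℝ) : ℂ) + 1) •
    q ((ε + t : ℝ) : ℂ)))) h2
  linarith

variable [CompleteSpace B]

theorem continuousOn (hq : IsQuasiResolvent x q) (hι : Isometry ι) :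
    ContinuousOn (fun t : ℝ => ((t : ℂ) + 1) • q t) (Ioi 0) := by
  rw [hι.isUniformInducing.isInducing.continuousOn_iff]
  have := continuousOn_powKernelOp (fun z hz => hq.isUnit ι hz) (le_refl 0)
  simp only [Complex.ofReal_zero, map_zero, add_zero] at this
  exact this.congr fun t ht => (hq.powKernelOp_eq ι ht).symm

theorem integrable (hq : IsQuasiResolvent x q) (hι : Isometry ι) (hr : r ∈ Ioo 0 1) :
    Integrable (fun t : ℝ => rpowIntegrand₀₁ r t 1 • (((t : ℂ) + 1) • q t))
      (volume.restrict (Ioi 0)) :=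
  integrable_weight_smul hr (hq.continuousOn hι) fun _ ht => hq.norm_add_one_smul_le ht

variable [CompleteSpace A]

/-- Real linearity of `L` allows both the identity of `B`, for the limit, and the real part of a
state, for positivity. -/
theorem clm_quasiPow (hq : IsQuasiResolvent x q) (hι : Isometry ι) (hr : r ∈ Ioo 0 1)
    {E : Type*} [NormedAddCommGroup E] [NormedSpace ℝ E] [CompleteSpace E] (L : B →L[ℝ] E) :
    L (ι (quasiPow r q)) =
      (weightMass r)⁻¹ • ∫ t in Ioi 0, rpowIntegrand₀₁ r t 1 • L (powKernelOp t (ι x)) := by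
  obtain ⟨J, hJ⟩ := continuous_clm hι
  have := ContinuousLinearMap.integral_comp_comm (L.comp (J.restrictScalars ℝ))
    (hq.integrable hι hr)
  have e : L (ι (quasiPow r q)) = (L.comp (J.restrictScalars ℝ)) (quasiPow r q) := by
    simp [hJ]
  rw [e, quasiPow, map_smul, ← this]
  congr 1
  refine setIntegral_congr_fun measurableSet_Ioi fun t ht => ?_
  simp only [map_smul]
  rw [hq.powKernelOp_eq ι ht, ← hJ]
  rfl

variable [NormOneClass B]

theorem isPrincipalPow (hq : IsQuasiResolvent x q) (hι : Isometry ι) (hr : r ∈ Ioo 0 1) :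
    IsPrincipalPow r (ι x) (ι (quasiPow r q)) := by
  have hu : ∀ z : ℂ, 0 < z.re → IsUnit (ι x + algebraMap ℂ B z) := fun z hz => hq.isUnit ι hz
  refine ⟨_, fun ε hε => isRieszPow_integral hu hε hr, ?_⟩
  have e := hq.clm_quasiPow hι hr (ContinuousLinearMap.id ℝ B)
  simp only [ContinuousLinearMap.id_apply] at e
  rw [e]
  refine Tendsto.const_smul ?_ _
  refine tendsto_integral_filter_of_dominated_convergence
    (fun t => rpowIntegrand₀₁ r t 1 * (3 * ‖x‖ + 3)) ?_ ?_ ((integrable_weight hr).mul_const _) ?_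
  · filter_upwards [self_mem_nhdsWithin] with ε hε
    exact (integrable_weight hr).aestronglyMeasurable.smul
      ((continuousOn_powKernelOp hu (le_of_lt hε)).aestronglyMeasurable measurableSet_Ioi)
  · filter_upwards [self_mem_nhdsWithin, nhdsWithin_le_nhds (gt_mem_nhds one_pos)] with ε hε hε1
    filter_upwards [ae_restrict_mem measurableSet_Ioi] with t ht
    rw [norm_smul, Real.norm_of_nonneg (weight_nonneg hr ht)]
    exact mul_le_mul_of_nonneg_left (hq.norm_powKernelOp_le hι hε (le_of_lt hε1) ht)
      (weight_nonneg hr ht)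
  · filter_upwards [ae_restrict_mem measurableSet_Ioi] with t ht
    exact (tendsto_powKernelOp (hu t (by simpa using ht))).const_smul _

theorem quasiPow_mem_realPosIn (hq : IsQuasiResolvent x q) (hι : Isometry ι) (hr : r ∈ Ioo 0 1)
    (hx : x ∈ realPosIn ι) : quasiPow r q ∈ realPosIn ι := by
  rintro _ ⟨φ, hφ, hφ1, rfl⟩
  have e := hq.clm_quasiPow hι hr (Complex.reCLM.comp (φ.restrictScalars ℝ))
  change 0 ≤ (φ (ι (quasiPow r q))).re
  change (φ (ι (quasiPow r q))).re = _ at e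
  rw [e]
  refine smul_nonneg (inv_nonneg.2 (weightMass_pos hr).le)
    (setIntegral_nonneg measurableSet_Ioi fun t ht => ?_)
  have ht : 0 < t := ht
  refine smul_nonneg (weight_nonneg hr ht) ?_
  change 0 ≤ (φ (powKernelOp t (ι x))).re
  have h1 : t * ‖Ring.inverse (ι x + algebraMap ℂ B t)‖ ≤ 1 := by
    have := norm_inverse_le hx (Ring.mul_inverse_cancel _
      (hq.isUnit ι (z := (t : ℂ)) (by simpa using ht)))
    rwa [Complex.ofReal_re] at this
  have h2 : ‖(t : ℂ) * φ (Ring.inverse (ι x + algebraMap ℂ B t))‖ ≤ 1 := by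
    rw [norm_mul, Complex.norm_real, Real.norm_of_nonneg ht.le]
    refine le_trans (mul_le_mul_of_nonneg_left (φ.le_opNorm _) ht.le) ?_
    rwa [hφ, one_mul]
  have h3 := (Complex.re_le_norm _).trans h2
  have e2 : φ (powKernelOp t (ι x)) =
      ((t + 1 : ℝ) : ℂ) * (1 - (t : ℂ) * φ (Ring.inverse (ι x + algebraMap ℂ B t))) := by
    rw [powKernelOp, map_smul, map_sub, map_smul, hφ1]
    push_cast; rfl
  rw [e2, Complex.re_ofReal_mul, Complex.sub_re, Complex.one_re]
  exact mul_nonneg (by positivity) (by linarith)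

end IsQuasiResolvent

end QuasiPow

/-! ### Conclusion, with the endpoint exponents. -/

theorem mem_realPosIn_of_map_eq_one {A B : Type*} [NonUnitalNormedRing A] [NormedSpace ℂ A]
    [NormedRing B] [NormedAlgebra ℂ B] {ι : A →ₙₐ[ℂ] B} {e : A} (he : ι e = 1) :
    e ∈ realPosIn ι := by
  rintro _ ⟨φ, -, hφ1, rfl⟩
  simp [he, hφ1]

theorem corollary6 (A : Type u) [NonUnitalNormedRing A] [NormedSpace ℂ A]
    [IsScalarTower ℂ A A] [SMulCommClass ℂ A A] [CompleteSpace A] :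
    (∀ r : ℝ, 0 ≤ r → r ≤ 1 → ∀ x ∈ realPos A, ∃ y ∈ realPos A,
      ∀ (B : Type u) [NormedRing B] [NormedAlgebra ℂ B] [NormOneClass B] [CompleteSpace B]
        (ι : A →ₙₐ[ℂ] B), Isometry ι → (0 < r ∨ (1 : B) ∈ Set.range ι) →
        IsPrincipalPow r (ι x) (ι y)) ∧
    (∀ (B : Type v) [NormedRing B] [NormedAlgebra ℂ B] [NormOneClass B] [CompleteSpace B]
      (ι : A →ₙₐ[ℂ] B), Isometry ι →
      ∀ r : ℝ, 0 ≤ r → r ≤ 1 → (0 < r ∨ (1 : B) ∈ Set.range ι) →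
        ∀ x ∈ realPosIn ι, ∃ y ∈ realPosIn ι, IsPrincipalPow r (ι x) (ι y)) := by
  constructor
  · rintro r h0 h1 x ⟨B₀, _, _, _, _, ι₀, hι₀, hx⟩
    -- Obtained from `B₀`, this `q` lives in `A` and serves every `B` below.
    obtain ⟨q, hq⟩ := exists_isQuasiResolvent hι₀ hx
    rcases h0.eq_or_lt with rfl | h0
    · by_cases hone : ∃ (B : Type u) (_ : NormedRing B) (_ : NormedAlgebra ℂ B)
          (_ : NormOneClass B) (_ : CompleteSpace B) (ι : A →ₙₐ[ℂ] B), Isometry ι ∧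
          (1 : B) ∈ Set.range ι
      · obtain ⟨B₁, _, _, _, _, ι₁, hι₁, e, he⟩ := hone
        refine ⟨e, ⟨B₁, _, _, ‹_›, ‹_›, ι₁, hι₁, mem_realPosIn_of_map_eq_one he⟩, ?_⟩
        intro B _ _ _ _ ι hι hB
        obtain ⟨f, hf⟩ := hB.resolve_left (lt_irrefl 0)
        -- Both are two-sided identities of `A`, so the choice of `B₁` does not matter.
        have hef : e = f := by
          have h2 : e * f = e := hι.injective (by rw [map_mul, hf, mul_one])
          have h3 : e * f = f := hι₁.injective (by rw [map_mul, he, one_mul])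
          exact h2.symm.trans h3
        rw [hef, hf]
        exact isPrincipalPow_zero fun z hz => hq.isUnit ι hz
      -- No `B` has its identity in `A`, so the condition on the power is vacuous and any member of
      -- `realPos A` will do.
      · refine ⟨x, ⟨B₀, _, _, ‹_›, ‹_›, ι₀, hι₀, hx⟩, ?_⟩
        intro B _ _ _ _ ι hι hB
        exact absurd ⟨B, _, _, ‹_›, ‹_›, ι, hι, hB.resolve_left (lt_irrefl 0)⟩ hone
    rcases h1.eq_or_lt with rfl | h1
    · refine ⟨x, ⟨B₀, _, _, ‹_›, ‹_›, ι₀, hι₀, hx⟩, ?_⟩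
      intro B _ _ _ _ ι _ _
      exact isPrincipalPow_one fun z hz => hq.isUnit ι hz
    · refine ⟨quasiPow r q, ⟨B₀, _, _, ‹_›, ‹_›, ι₀, hι₀,
        hq.quasiPow_mem_realPosIn hι₀ ⟨h0, h1⟩ hx⟩, ?_⟩
      intro B _ _ _ _ ι hι _
      exact hq.isPrincipalPow hι ⟨h0, h1⟩
  · intro B _ _ _ _ ι hι r h0 h1 hB x hx
    obtain ⟨q, hq⟩ := exists_isQuasiResolvent hι hx
    rcases h0.eq_or_lt with rfl | h0
    · obtain ⟨e, he⟩ := hB.resolve_left (lt_irrefl 0)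
      exact ⟨e, mem_realPosIn_of_map_eq_one he,
        he ▸ isPrincipalPow_zero fun z hz => hq.isUnit ι hz⟩
    rcases h1.eq_or_lt with rfl | h1
    · exact ⟨x, hx, isPrincipalPow_one fun z hz => hq.isUnit ι hz⟩
    · exact ⟨quasiPow r q, hq.quasiPow_mem_realPosIn hι ⟨h0, h1⟩ hx,
        hq.isPrincipalPow hι ⟨h0, h1⟩⟩
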